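/- Let $(\Omega,\mathcal F)$ be a measurable space and let $\mathbb F$ be the space of all bounded $\mathcal F$-measurable functions $\Omega\to\mathbb R$. Let $\rho:\mathbb F\to\mathbb R$ be a sublinear operator, that is, for all $\xi_1,\xi_2,\xi\in\mathbb F$: - (monotonicity) $\rho(\xi_1)\ge\rho(\xi_2)$ whenever $\xi_1\ge\xi_2$ pointwise; - (constant preserving) $\rho(c)=c$ for every $c\in\mathbb R$; - (sub-additivity) $\rho(\xi_1+\xi_2)\le\rho(\xi_1)+\rho(\xi_2)$; - (positive homogeneity) $\rho(\lambda\xi)=\lambda\rho(\xi)$ for every $\lambda\ge 0$. Call $\rho$ continuous from above on $\mathcal F$ if for every sequence $(\xi_n)$ in $\mathbb F$ which decreases pointwise to $0$ on $\Omega$, one has $\rho(\xi_n)\downarrow 0$. Then $\rho$ is continuous from above on $\mathcal F$ if and only if there exist a probability measure $P_0$ and a family $\mathcal P$ of probability measures on $(\Omega,\mathcal F)$ such that i) $\rho(X)=\sup_{P\in\mathcal P}E_P[X]$ for all $X\in\mathbb F$; ii) every element of $\mathcal P$ is absolutely continuous with respect to $P_0$; iii) the set of densities $\left\{\frac{dP}{dP_0}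 : P\in\mathcal P\right\}\subset L^1(P_0)$ is compact in the weak topology $\sigma(L^1(P_0),L^\infty(P_0))$. -/

import Mathlib

open MeasureTheory Filter Topology
open scoped ENNReal

/-- The vector space `𝔽` of all bounded measurable functions `Ω → ℝ` (genuine functions,
not classes modulo null sets). -/
def boundedMeasurable (Ω : Type*) [MeasurableSpace Ω] : Submodule ℝ (Ω → ℝ) where
  carrier := {X | Measurable X ∧ ∃ C : ℝ, ∀ ω, |X ω| ≤ C}
  add_mem' := by
    rintro X Y ⟨hX, C, hC⟩ ⟨hY, D, hD⟩
    exact ⟨hX.add hY, C + D, fun ω => (abs_add_le _ _).trans (add_le_add (hC ω) (hD ω))⟩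
  zero_mem' := ⟨measurable_const, 0, fun ω => by simp⟩
  smul_mem' := by
    rintro c X ⟨hX, C, hC⟩
    refine ⟨hX.const_smul c, |c| * C, fun ω => ?_⟩
    simp only [Pi.smul_apply, smul_eq_mul, abs_mul]
    exact mul_le_mul_of_nonneg_left (hC ω) (abs_nonneg c)

/-- The constant function `c` as an element of `𝔽`. -/
def boundedConst (Ω : Type*) [MeasurableSpace Ω] (c : ℝ) : boundedMeasurable Ω :=
  ⟨fun _ => c, measurable_const, |c|, fun _ => le_rfl⟩

/-- A sublinear operator `ρ : 𝔽 → ℝ`. -/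
structure IsSublinearOperator {Ω : Type*} [MeasurableSpace Ω]
    (ρ : boundedMeasurable Ω → ℝ) : Prop where
  monotone : ∀ X Y : boundedMeasurable Ω,
    (∀ ω, (Y : Ω → ℝ) ω ≤ (X : Ω → ℝ) ω) → ρ Y ≤ ρ X
  map_const : ∀ c : ℝ, ρ (boundedConst Ω c) = c
  subadditive : ∀ X Y : boundedMeasurable Ω, ρ (X + Y) ≤ ρ X + ρ Y
  pos_homogeneous : ∀ (c : ℝ) (X : boundedMeasurable Ω), 0 ≤ c → ρ (c • X) = c * ρ X

/-- Continuity from above: `ξ n ↓ 0` pointwise on `Ω` implies `ρ (ξ n) ↓ 0`. -/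
def IsContinuousFromAbove {Ω : Type*} [MeasurableSpace Ω]
    (ρ : boundedMeasurable Ω → ℝ) : Prop :=
  ∀ ξ : ℕ → boundedMeasurable Ω,
    (∀ ω, Antitone fun n => (ξ n : Ω → ℝ) ω) →
    (∀ ω, Tendsto (fun n => (ξ n : Ω → ℝ) ω) atTop (𝓝 0)) →
    Antitone (fun n => ρ (ξ n)) ∧ Tendsto (fun n => ρ (ξ n)) atTop (𝓝 0)

/-- The duality `⟨f, g⟩ = ∫ f g dμ` between `L¹(μ)` and `L^∞(μ)`. -/
noncomputable def pairingL1Linfty {Ω : Type*} [MeasurableSpace Ω] (μ : Measure Ω) :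
    Lp ℝ 1 μ →ₗ[ℝ] Lp ℝ ∞ μ →ₗ[ℝ] ℝ :=
  ((ContinuousLinearMap.mul ℝ ℝ).lpPairing μ 1 ∞).toLinearMap₁₂

theorem pairingL1Linfty_apply {Ω : Type*} [MeasurableSpace Ω] (μ : Measure Ω)
    (f : Lp ℝ 1 μ) (g : Lp ℝ ∞ μ) :
    pairingL1Linfty μ f g = ∫ ω, f ω * g ω ∂μ := by
  simp [pairingL1Linfty, ContinuousLinearMap.lpPairing_eq_integral]

/-- `L¹(μ)` with the topology `σ(L¹(μ), L^∞(μ))`. -/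
abbrev WeakL1 {Ω : Type*} [MeasurableSpace Ω] (μ : Measure Ω) : Type _ :=
  WeakBilin (pairingL1Linfty μ)

/-- The identity map from `L¹(μ)` to `L¹(μ)` with its weak topology. -/
noncomputable def toWeakL1 {Ω : Type*} [MeasurableSpace Ω] (μ : Measure Ω) :
    Lp ℝ 1 μ ≃ₗ[ℝ] WeakL1 μ :=
  LinearEquiv.refl ℝ (Lp ℝ 1 μ)

/-- The Radon-Nikodym density `dP/dP₀` as an element of `L¹(P₀)`
(used only for `P ≪ P₀`). -/
noncomputable def densityL1 {Ω : Type*} [MeasurableSpace Ω] (P₀ P : ProbabilityMeasure Ω) :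
    Lp ℝ 1 (P₀ : Measure Ω) :=
  Integrable.toL1 (fun ω => ((P : Measure Ω).rnDeriv (P₀ : Measure Ω) ω).toReal)
    Measure.integrable_toReal_rnDeriv

/-- The set of densities `{dP/dP₀ : P ∈ Pfam}`, viewed in `L¹(P₀)` with its
`σ(L¹(P₀), L^∞(P₀))` topology. -/
def densitySet {Ω : Type*} [MeasurableSpace Ω] (P₀ : ProbabilityMeasure Ω)
    (Pfam : Set (ProbabilityMeasure Ω)) : Set (WeakL1 (P₀ : Measure Ω)) :=
  (fun P => toWeakL1 (P₀ : Measure Ω) (densityL1 P₀ P)) '' Pfam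

/-! By Hahn-Banach, `ρ` is the pointwise maximum of the linear functionals it dominates. Such a
functional is positive and normalised, and it inherits continuity from above, hence is
sigma-additive on indicators and equals integration against a probability measure
(`exists_integral_eq`). So `dominatedMeasures ρ` represents `ρ`. Since `ρ` bounds all these measures
at once, they are uniformly small along sets decreasing to the empty set, which yields a common
dominating measure (`exists_dominating_probabilityMeasure`). The dominated functionals are pointwise
compact by Tychonoff, and the map sending them to densities is weakly continuous because each class
in `L^∞` has a bounded measurable representative. Conversely, if `ξ n` decreases to zero, the
expectations are weakly continuous functions of the density decreasing to zero on a compact set.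
Dini's theorem makes the convergence uniform, so their suprema `ρ (ξ n)` tend to zero. -/

/-! ### Indicators and integrals of bounded measurable functions -/

/-- The indicator of a measurable set as an element of `𝔽`. -/
noncomputable def boundedIndicator {Ω : Type*} [MeasurableSpace Ω] (A : Set Ω)
    (hA : MeasurableSet A) : boundedMeasurable Ω :=
  ⟨A.indicator fun _ => 1, measurable_const.indicator hA, 1, fun ω => by
    by_cases h : ω ∈ A <;> simp [h]⟩

theorem boundedIndicator_of_mem {Ω : Type*} [MeasurableSpace Ω] {A : Set Ω}
    (hA : MeasurableSet A) {ω : Ω} (h : ω ∈ A) : (boundedIndicator A hA : Ω → ℝ) ω = 1 :=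
  Set.indicator_of_mem h fun _ => (1 : ℝ)

theorem boundedIndicator_of_notMem {Ω : Type*} [MeasurableSpace Ω] {A : Set Ω}
    (hA : MeasurableSet A) {ω : Ω} (h : ω ∉ A) : (boundedIndicator A hA : Ω → ℝ) ω = 0 :=
  Set.indicator_of_notMem h fun _ => (1 : ℝ)

theorem boundedIndicator_nonneg {Ω : Type*} [MeasurableSpace Ω] {A : Set Ω}
    (hA : MeasurableSet A) (ω : Ω) : 0 ≤ (boundedIndicator A hA : Ω → ℝ) ω :=
  Set.indicator_nonneg (fun _ _ => zero_le_one) ω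

theorem boundedMeasurable.integrable {Ω : Type*} [MeasurableSpace Ω] (X : boundedMeasurable Ω)
    (P : Measure Ω) [IsFiniteMeasure P] : Integrable (X : Ω → ℝ) P := by
  obtain ⟨C, hC⟩ := X.2.2
  exact Integrable.of_bound X.2.1.aestronglyMeasurable C (ae_of_all _ hC)

theorem integral_boundedIndicator {Ω : Type*} [MeasurableSpace Ω] (A : Set Ω)
    (hA : MeasurableSet A) (P : Measure Ω) :
    ∫ ω, (boundedIndicator A hA : Ω → ℝ) ω ∂P = P.real A := by
  simp [boundedIndicator, integral_indicator hA]

/-- A probability measure is determined by the integrals of bounded measurable functions. -/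
theorem probabilityMeasure_ext_of_integral_boundedMeasurable {Ω : Type*} [MeasurableSpace Ω]
    {P Q : ProbabilityMeasure Ω}
    (h : ∀ X : boundedMeasurable Ω,
      ∫ ω, (X : Ω → ℝ) ω ∂(P : Measure Ω) = ∫ ω, (X : Ω → ℝ) ω ∂(Q : Measure Ω)) : P = Q := by
  refine Subtype.ext (Measure.ext fun A hA => ?_)
  have := h (boundedIndicator A hA)
  rw [integral_boundedIndicator, integral_boundedIndicator] at this
  exact (measureReal_eq_measureReal_iff (measure_ne_top (P : Measure Ω) A)
    (measure_ne_top (Q : Measure Ω) A)).1 this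

/-- Integrals of bounded measurable functions decreasing to zero tend to zero. -/
theorem tendsto_integral_boundedMeasurable_of_antitone {Ω : Type*} [MeasurableSpace Ω]
    (P : Measure Ω) [IsFiniteMeasure P] {ξ : ℕ → boundedMeasurable Ω}
    (hanti : ∀ ω, Antitone fun n => (ξ n : Ω → ℝ) ω)
    (hlim : ∀ ω, Tendsto (fun n => (ξ n : Ω → ℝ) ω) atTop (𝓝 0)) :
    Tendsto (fun n => ∫ ω, (ξ n : Ω → ℝ) ω ∂P) atTop (𝓝 0) := by
  simpa using integral_tendsto_of_tendsto_of_antitone (f := fun n => (ξ n : Ω → ℝ))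
    (F := fun _ => (0 : ℝ)) (fun n => boundedMeasurable.integrable (ξ n) P) (integrable_zero _ _ _)
    (ae_of_all _ hanti) (ae_of_all _ hlim)

/-! ### Linear functionals dominated by a sublinear operator -/

namespace IsSublinearOperator

variable {Ω : Type*} [MeasurableSpace Ω] {ρ : boundedMeasurable Ω → ℝ}

theorem map_zero (hρ : IsSublinearOperator ρ) : ρ 0 = 0 := by
  simpa using hρ.pos_homogeneous 0 0 le_rfl

/-- Every value of a sublinear operator is attained by a dominated linear functional. -/
theorem exists_linear_le (hρ : IsSublinearOperator ρ) (X : boundedMeasurable Ω) :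
    ∃ L : boundedMeasurable Ω →ₗ[ℝ] ℝ, (∀ Y, L Y ≤ ρ Y) ∧ L X = ρ X := by
  have H : ∀ c : ℝ, c • X = 0 → c • ρ X = 0 := by
    intro c hc
    rcases smul_eq_zero.1 hc with h | h
    · simp [h]
    · simp [h, hρ.map_zero]
  obtain ⟨g, hg, hle⟩ := exists_extension_of_le_sublinear
    (LinearPMap.mkSpanSingleton' X (ρ X) H) ρ (fun c hc x => hρ.pos_homogeneous c x hc.le)
    hρ.subadditive (by
      rintro ⟨x, hx⟩
      obtain ⟨c, rfl⟩ := Submodule.mem_span_singleton.1 hx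
      rw [LinearPMap.mkSpanSingleton'_apply]
      simp only [RingHom.id_apply, smul_eq_mul]
      rcases le_total 0 c with hc | hc
      · exact (hρ.pos_homogeneous c X hc).ge
      -- For `c ≤ 0`, `0 = ρ 0 ≤ ρ (c • X) + ρ ((-c) • X)` gives `c * ρ X ≤ ρ (c • X)`.
      · have h1 := hρ.subadditive (c • X) ((-c) • X)
        rw [← add_smul, add_neg_cancel, zero_smul, hρ.map_zero,
          hρ.pos_homogeneous (-c) X (by linarith)] at h1
        linarith)
  refine ⟨g, hle, ?_⟩
  exact (hg ⟨X, Submodule.mem_span_singleton_self X⟩).trans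
    (LinearPMap.mkSpanSingleton'_apply_self _ _ _ _)

variable {L : boundedMeasurable Ω →ₗ[ℝ] ℝ}

theorem nonneg_of_linear_le (hρ : IsSublinearOperator ρ) (hL : ∀ Y, L Y ≤ ρ Y)
    (X : boundedMeasurable Ω) (hX : ∀ ω, 0 ≤ (X : Ω → ℝ) ω) : 0 ≤ L X := by
  have h1 := (hL (-X)).trans (hρ.monotone 0 (-X) fun ω => by
    simpa using hX ω)
  rw [hρ.map_zero, map_neg] at h1
  linarith

theorem linear_map_const (hρ : IsSublinearOperator ρ) (hL : ∀ Y, L Y ≤ ρ Y) (c : ℝ) :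
    L (boundedConst Ω c) = c := by
  have h1 := hL (boundedConst Ω c)
  have h2 := hL (boundedConst Ω (-c))
  have h3 : boundedConst Ω (-c) = - boundedConst Ω c := rfl
  rw [hρ.map_const] at h1 h2
  rw [h3, map_neg] at h2
  linarith

theorem abs_linear_le (hρ : IsSublinearOperator ρ) (hL : ∀ Y, L Y ≤ ρ Y)
    (X : boundedMeasurable Ω) {c : ℝ} (hX : ∀ ω, |(X : Ω → ℝ) ω| ≤ c) : |L X| ≤ c := by
  have key : ∀ Y : boundedMeasurable Ω, (∀ ω, (Y : Ω → ℝ) ω ≤ c) → L Y ≤ c := fun Y hY =>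
    (hL Y).trans ((hρ.monotone (boundedConst Ω c) Y hY).trans_eq (hρ.map_const c))
  refine abs_le'.2 ⟨key X fun ω => (abs_le'.1 (hX ω)).1, ?_⟩
  rw [← map_neg]
  exact key (-X) fun ω => (abs_le'.1 (hX ω)).2

/-- Squeeze: positivity gives `0 ≤ L (ξ n)` and domination gives `L (ξ n) ≤ ρ (ξ n)`. -/
theorem tendsto_linear (hρ : IsSublinearOperator ρ) (hc : IsContinuousFromAbove ρ)
    (hL : ∀ Y, L Y ≤ ρ Y) {ξ : ℕ → boundedMeasurable Ω}
    (hanti : ∀ ω, Antitone fun n => (ξ n : Ω → ℝ) ω)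
    (hlim : ∀ ω, Tendsto (fun n => (ξ n : Ω → ℝ) ω) atTop (𝓝 0)) :
    Tendsto (fun n => L (ξ n)) atTop (𝓝 0) :=
  tendsto_of_tendsto_of_tendsto_of_le_of_le tendsto_const_nhds (hc ξ hanti hlim).2
    (fun n => hρ.nonneg_of_linear_le hL _ fun ω => (hanti ω).le_of_tendsto (hlim ω) n)
    (fun _ => hL _)

/-- The remainders, indicator of the union minus partial sums, decrease pointwise to zero, so
`tendsto_linear` applies to them. -/
theorem hasSum_linear_boundedIndicator (hρ : IsSublinearOperator ρ)
    (hc : IsContinuousFromAbove ρ) (hL : ∀ Y, L Y ≤ ρ Y) {A : ℕ → Set Ω}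
    (hA : ∀ i, MeasurableSet (A i)) (hd : Pairwise (Function.onFun Disjoint A)) :
    HasSum (fun i => L (boundedIndicator (A i) (hA i)))
      (L (boundedIndicator (⋃ i, A i) (MeasurableSet.iUnion hA))) := by
  have hnn : ∀ i ω, 0 ≤ (boundedIndicator (A i) (hA i) : Ω → ℝ) ω := fun i =>
    boundedIndicator_nonneg (hA i)
  rw [hasSum_iff_tendsto_nat_of_nonneg fun i => hρ.nonneg_of_linear_le hL _ (hnn i)]
  set U := boundedIndicator (⋃ i, A i) (MeasurableSet.iUnion hA)
  set R : ℕ → boundedMeasurable Ω := fun n =>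
    U - ∑ i ∈ Finset.range n, boundedIndicator (A i) (hA i)
  have hR : ∀ n ω, (R n : Ω → ℝ) ω = (U : Ω → ℝ) ω -
      ∑ i ∈ Finset.range n, (boundedIndicator (A i) (hA i) : Ω → ℝ) ω := by
    intro n ω
    simp [R]
  have hsum : ∀ ω, HasSum (fun i => (boundedIndicator (A i) (hA i) : Ω → ℝ) ω)
      ((U : Ω → ℝ) ω) := by
    intro ω
    by_cases h : ∃ j, ω ∈ A j
    · obtain ⟨j, hj⟩ := h
      have : (U : Ω → ℝ) ω = (boundedIndicator (A j) (hA j) : Ω → ℝ) ω := by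
        rw [boundedIndicator_of_mem _ hj]
        exact boundedIndicator_of_mem _ (Set.mem_iUnion.2 ⟨j, hj⟩)
      rw [this]
      refine hasSum_single j fun i hi => boundedIndicator_of_notMem _ fun h => ?_
      exact Set.disjoint_left.1 (hd hi) h hj
    · have hU : ω ∉ ⋃ i, A i := by simpa using h
      have h0 : (U : Ω → ℝ) ω = 0 := boundedIndicator_of_notMem _ hU
      rw [h0]
      convert hasSum_zero with i
      exact boundedIndicator_of_notMem _ fun h' => h ⟨i, h'⟩
  have hlim := hρ.tendsto_linear hc hL (ξ := R)
    (fun ω => antitone_nat_of_succ_le fun n => by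
      rw [hR, hR, Finset.sum_range_succ]
      linarith [hnn n ω])
    (fun ω => by
      simp only [hR]
      simpa using (hsum ω).tendsto_sum_nat.const_sub ((U : Ω → ℝ) ω))
  have := hlim.const_sub (L U)
  simpa [R] using this

/-- The values of a dominated linear functional on indicators form a probability measure. -/
theorem exists_measure (hρ : IsSublinearOperator ρ)
    (hc : IsContinuousFromAbove ρ) (hL : ∀ Y, L Y ≤ ρ Y) :
    ∃ P : ProbabilityMeasure Ω, ∀ A (hA : MeasurableSet A),
      (P : Measure Ω).real A = L (boundedIndicator A hA) := by
  have hnn : ∀ A (hA : MeasurableSet A), 0 ≤ L (boundedIndicator A hA) := fun A hA =>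
    hρ.nonneg_of_linear_le hL _ (boundedIndicator_nonneg hA)
  let μ : Measure Ω := Measure.ofMeasurable
    (fun A hA => ENNReal.ofReal (L (boundedIndicator A hA)))
    (by
      have : boundedIndicator (∅ : Set Ω) MeasurableSet.empty = 0 :=
        Subtype.ext (Set.indicator_empty _)
      simp [this])
    (fun A hA hd => by
      have h := hρ.hasSum_linear_boundedIndicator hc hL hA hd
      rw [← h.tsum_eq, ENNReal.ofReal_tsum_of_nonneg (fun i => hnn _ _) h.summable])
  have hμ : ∀ A (hA : MeasurableSet A), μ A = ENNReal.ofReal (L (boundedIndicator A hA)) :=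
    fun A hA => Measure.ofMeasurable_apply A hA
  have hprob : IsProbabilityMeasure μ := ⟨by
    have : boundedIndicator (Set.univ : Set Ω) MeasurableSet.univ = boundedConst Ω 1 :=
      Subtype.ext (by simp [boundedIndicator, boundedConst])
    rw [hμ _ MeasurableSet.univ, this, hρ.linear_map_const hL, ENNReal.ofReal_one]⟩
  refine ⟨⟨μ, hprob⟩, fun A hA => ?_⟩
  change (μ A).toReal = _
  rw [hμ A hA, ENNReal.toReal_ofReal (hnn A hA)]

end IsSublinearOperator

/-! ### Integral representation of dominated functionals -/

/-- A bounded measurable function is a uniform limit of simple functions. -/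
theorem boundedMeasurable.exists_simpleFunc_near {Ω : Type*} [MeasurableSpace Ω]
    (X : boundedMeasurable Ω) {ε : ℝ} (hε : 0 < ε) :
    ∃ S : SimpleFunc Ω ℝ, ∀ ω, |(X : Ω → ℝ) ω - S ω| ≤ ε := by
  obtain ⟨hX, C, hC⟩ := X.2
  -- Round `X` down to a multiple of `ε`; boundedness leaves finitely many values.
  have hm : Measurable fun ω => ε * (⌊(X : Ω → ℝ) ω / ε⌋ : ℝ) := by fun_prop
  refine ⟨⟨fun ω => ε * (⌊(X : Ω → ℝ) ω / ε⌋ : ℝ), fun x => hm (measurableSet_singleton x), ?_⟩,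
    fun ω => ?_⟩
  · refine ((Set.finite_Icc ⌊-C / ε⌋ ⌊C / ε⌋).image fun k : ℤ => ε * (k : ℝ)).subset ?_
    rintro _ ⟨ω, rfl⟩
    have h := abs_le.1 (hC ω)
    exact ⟨_, ⟨Int.floor_mono (by gcongr; exact h.1), Int.floor_mono (by gcongr; exact h.2)⟩, rfl⟩
  · have h1 := Int.floor_le ((X : Ω → ℝ) ω / ε)
    have h2 := Int.lt_floor_add_one ((X : Ω → ℝ) ω / ε)
    rw [le_div_iff₀ hε] at h1
    rw [div_lt_iff₀ hε] at h2
    simp only [SimpleFunc.coe_mk]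
    rw [abs_le]
    constructor <;> linarith

theorem SimpleFunc.mem_boundedMeasurable {Ω : Type*} [MeasurableSpace Ω] (S : SimpleFunc Ω ℝ) :
    (S : Ω → ℝ) ∈ boundedMeasurable Ω :=
  ⟨S.measurable, S.exists_forall_norm_le⟩

namespace IsSublinearOperator

variable {Ω : Type*} [MeasurableSpace Ω] {ρ : boundedMeasurable Ω → ℝ}
  {L : boundedMeasurable Ω →ₗ[ℝ] ℝ}

/-- A linear functional dominated by a sublinear operator that is continuous from above is
integration against a probability measure. -/
theorem exists_integral_eq (hρ : IsSublinearOperator ρ)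
    (hc : IsContinuousFromAbove ρ) (hL : ∀ Y, L Y ≤ ρ Y) :
    ∃ P : ProbabilityMeasure Ω, ∀ X : boundedMeasurable Ω,
      ∫ ω, (X : Ω → ℝ) ω ∂(P : Measure Ω) = L X := by
  obtain ⟨P, hP⟩ := hρ.exists_measure hc hL
  have hS : ∀ S : SimpleFunc Ω ℝ, ∫ ω, S ω ∂(P : Measure Ω) =
      L ⟨S, SimpleFunc.mem_boundedMeasurable S⟩ := by
    intro S
    induction S using SimpleFunc.induction with
    | const c hs =>
      rename_i s
      have : (⟨_, SimpleFunc.mem_boundedMeasurable (SimpleFunc.piecewise s hs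
          (SimpleFunc.const Ω c) (SimpleFunc.const Ω 0))⟩ : boundedMeasurable Ω) =
          c • boundedIndicator s hs := by
        apply Subtype.ext
        funext ω
        by_cases h : ω ∈ s <;> simp [boundedIndicator, h]
      have h2 : ∀ ω, (SimpleFunc.piecewise s hs
          (SimpleFunc.const Ω c) (SimpleFunc.const Ω 0)) ω =
          c * (boundedIndicator s hs : Ω → ℝ) ω := fun ω =>
        congrFun (congrArg Subtype.val this) ω
      rw [this, map_smul, ← hP s hs, ← integral_boundedIndicator s hs]
      simp only [h2]
      rw [integral_const_mul, smul_eq_mul]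
    | add _ ihf ihg =>
      rename_i f g _
      have : (⟨_, SimpleFunc.mem_boundedMeasurable (f + g)⟩ : boundedMeasurable Ω) =
        ⟨_, SimpleFunc.mem_boundedMeasurable f⟩ + ⟨_, SimpleFunc.mem_boundedMeasurable g⟩ := rfl
      rw [this, map_add, ← ihf, ← ihg]
      exact integral_add f.integrable_of_isFiniteMeasure g.integrable_of_isFiniteMeasure
  refine ⟨P, fun X => eq_of_abs_sub_le_all fun ε hε => ?_⟩
  obtain ⟨S, hXS⟩ := boundedMeasurable.exists_simpleFunc_near X (half_pos hε)
  set Y : boundedMeasurable Ω := ⟨S, SimpleFunc.mem_boundedMeasurable S⟩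
  have h1 : |L (X - Y)| ≤ ε / 2 := hρ.abs_linear_le hL _ hXS
  have h2 : |∫ ω, ((X : Ω → ℝ) ω - S ω) ∂(P : Measure Ω)| ≤ ε / 2 := by
    simpa using norm_integral_le_of_norm_le_const (μ := (P : Measure Ω))
      (f := fun ω => (X : Ω → ℝ) ω - S ω) (ae_of_all _ hXS)
  rw [integral_sub (boundedMeasurable.integrable X _) S.integrable_of_isFiniteMeasure, hS S] at h2
  rw [map_sub] at h1
  rw [abs_le] at *
  constructor <;> linarith

end IsSublinearOperator

/-! ### Existence of a dominating probability measure -/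

/-- A family of probability measures that is uniformly continuous at the empty set is dominated
by a single probability measure. -/
theorem exists_dominating_probabilityMeasure {Ω : Type*} [MeasurableSpace Ω]
    {S : Set (ProbabilityMeasure Ω)} (hS : S.Nonempty)
    (h : ∀ B : ℕ → Set Ω, (∀ n, MeasurableSet (B n)) → Antitone B → ⋂ n, B n = ∅ →
      ∀ ε : ℝ≥0∞, ε ≠ 0 → ∃ n, ∀ P ∈ S, (P : Measure Ω) (B n) ≤ ε) :
    ∃ P₀ : ProbabilityMeasure Ω, ∀ P ∈ S, (P : Measure Ω) ≪ (P₀ : Measure Ω) := by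
  have key : ∀ ε : ℝ≥0∞, ε ≠ 0 → ∃ F : Finset (ProbabilityMeasure Ω), ∀ A, MeasurableSet A →
      (∀ Q ∈ F, (Q : Measure Ω) A = 0) → ∀ P ∈ S, (P : Measure Ω) A ≤ ε := by
    classical
    intro ε hε
    by_contra! hF
    -- Failure of the claim produces pairs `(P n, A n)` with `P n (A n) > ε` and `P m (A n) = 0` for
    -- `m < n`.
    obtain ⟨x, hx, hr⟩ := exists_seq_of_forall_finset_exists
      (fun x : ProbabilityMeasure Ω × Set Ω =>
        x.1 ∈ S ∧ MeasurableSet x.2 ∧ ε < (x.1 : Measure Ω) x.2)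
      (fun x y => (x.1 : Measure Ω) y.2 = 0) (by
        intro s _
        obtain ⟨A, hA, hnull, P, hP, hlt⟩ := hF (s.image Prod.fst)
        exact ⟨(P, A), ⟨hP, hA, hlt⟩, fun y hy => hnull y.1 (Finset.mem_image_of_mem _ hy)⟩)
    set B : ℕ → Set Ω := fun n => ⋃ m ≥ n, (x m).2
    have hBm : ∀ n, MeasurableSet (B n) := fun n =>
      MeasurableSet.biUnion (Set.to_countable _) fun m _ => (hx m).2.1
    have hBanti : Antitone B := fun m n hmn =>
      Set.biUnion_subset_biUnion_left fun k (hk : n ≤ k) => hmn.trans hk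
    -- The tail from `m + 1` on contains only sets null for the `m`-th measure.
    have hnull : ∀ m, ((x m).1 : Measure Ω) (⋂ n, B n) = 0 := fun m =>
      measure_mono_null (Set.iInter_subset B (m + 1))
        ((measure_biUnion_null_iff (Set.to_countable _)).2 fun k hk => hr m k hk)
    -- Removing the limit set makes the intersection empty without changing the `n`-th measure of `B
    -- n`, which stays above `ε`.
    obtain ⟨n, hn⟩ := h (fun n => B n \ ⋂ k, B k)
      (fun n => (hBm n).diff (MeasurableSet.iInter hBm))
      (fun m n hmn => Set.sdiff_subset_sdiff_left (hBanti hmn))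
      (by
        ext ω
        simp only [Set.mem_iInter, Set.mem_sdiff, Set.mem_empty_iff_false, iff_false]
        intro hω
        exact (hω 0).2 fun k => (hω k).1) ε hε
    have h1 := hn _ (hx n).1
    rw [measure_sdiff_null (hnull n)] at h1
    have h2 : (x n).2 ⊆ B n := Set.subset_biUnion_of_mem (u := fun m => (x m).2)
      (show n ∈ {m | m ≥ n} from le_refl n)
    exact absurd ((hx n).2.2.trans_le (measure_mono h2)) h1.not_gt
  choose! F hF using key
  obtain ⟨P₁, hP₁⟩ := hS
  -- A set null for all of `D` has `P`-measure at most `1 / k` for every `k`, hence zero. Including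
  -- `P₁` makes the sum `ν` nonzero, so that `ν.toFinite` is a probability measure.
  let D : Set (ProbabilityMeasure Ω) := insert P₁ (⋃ k : ℕ, (F (k : ℝ≥0∞)⁻¹ : Set _))
  have hD : D.Countable :=
    (Set.countable_iUnion fun k : ℕ => (F (k : ℝ≥0∞)⁻¹).countable_toSet).insert P₁
  have : Countable D := hD.to_subtype
  let ν : Measure Ω := Measure.sum fun P : D => ((P : ProbabilityMeasure Ω) : Measure Ω)
  have hle : ∀ P ∈ D, (P : Measure Ω) ≤ ν := fun P hP =>
    Measure.le_sum (fun P : D => ((P : ProbabilityMeasure Ω) : Measure Ω)) ⟨P, hP⟩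
  have hν : NeZero ν := ⟨fun h0 => by
    have := hle P₁ (Set.mem_insert _ _) Set.univ
    simp [h0] at this⟩
  refine ⟨⟨ν.toFinite, inferInstance⟩, fun P hP => ?_⟩
  refine Measure.AbsolutelyContinuous.trans (Measure.AbsolutelyContinuous.mk fun A hA h0 => ?_)
    (absolutelyContinuous_toFinite ν)
  by_contra hne
  obtain ⟨k, hk⟩ := ENNReal.exists_inv_nat_lt hne
  refine absurd (hF (k : ℝ≥0∞)⁻¹ (by simp) A hA (fun Q hQ => ?_) P hP) hk.not_ge
  exact le_antisymm ((hle Q (Set.mem_insert_of_mem _ (Set.mem_iUnion.2 ⟨k, hQ⟩)) A).trans h0.le)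
    zero_le

/-! ### Weak compactness of the densities -/

/-- An element of `L^∞` has a bounded measurable representative. -/
theorem exists_boundedMeasurable_ae_eq {Ω : Type*} [MeasurableSpace Ω] {μ : Measure Ω}
    (g : Lp ℝ ∞ μ) : ∃ X : boundedMeasurable Ω, (X : Ω → ℝ) =ᵐ[μ] g := by
  set C : ℝ := (eLpNorm g ∞ μ).toReal
  have hb : ∀ᵐ ω ∂μ, |g ω| ≤ C := by
    filter_upwards [ae_le_eLpNormEssSup (f := (g : Ω → ℝ)) (μ := μ)] with ω hω
    rw [← eLpNorm_exponent_top] at hω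
    simpa only [toReal_enorm, Real.norm_eq_abs] using
      ENNReal.toReal_mono (Lp.memLp g).eLpNorm_ne_top hω
  have hC : 0 ≤ C := ENNReal.toReal_nonneg
  have hm := (Lp.stronglyMeasurable g).measurable
  refine ⟨⟨fun ω => max (-C) (min C (g ω)), by fun_prop, C, fun ω => ?_⟩, ?_⟩
  · exact abs_le.2 ⟨le_max_left _ _, max_le (by linarith) (min_le_left _ _)⟩
  · filter_upwards [hb] with ω hω
    rw [abs_le] at hω
    rw [min_eq_right hω.2, max_eq_right hω.1]

/-- Pairing a density with an element of `L^∞` is integration of any representative. -/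
theorem pairing_densityL1 {Ω : Type*} [MeasurableSpace Ω] {P₀ P : ProbabilityMeasure Ω}
    (hP : (P : Measure Ω) ≪ (P₀ : Measure Ω)) (g : Lp ℝ ∞ (P₀ : Measure Ω)) {X : Ω → ℝ}
    (hX : X =ᵐ[(P₀ : Measure Ω)] g) :
    pairingL1Linfty (P₀ : Measure Ω) (densityL1 P₀ P) g = ∫ ω, X ω ∂(P : Measure Ω) := by
  rw [pairingL1Linfty_apply, ← integral_toReal_rnDeriv_mul hP]
  refine integral_congr_ae ?_
  filter_upwards [hX, Integrable.coeFn_toL1 (μ := (P₀ : Measure Ω))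
    (f := fun ω => ((P : Measure Ω).rnDeriv (P₀ : Measure Ω) ω).toReal)
    Measure.integrable_toReal_rnDeriv] with ω h1 h2
  rw [h1, densityL1, h2]

namespace IsSublinearOperator

variable {Ω : Type*} [MeasurableSpace Ω] {ρ : boundedMeasurable Ω → ℝ}

/-- The linear functionals dominated by `ρ` are compact for pointwise convergence. -/
theorem isCompact_linear_le (ρ : boundedMeasurable Ω → ℝ) :
    IsCompact {f : boundedMeasurable Ω → ℝ |
      ∃ L : boundedMeasurable Ω →ₗ[ℝ] ℝ, (L : boundedMeasurable Ω → ℝ) = f ∧ ∀ X, L X ≤ ρ X} := by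
  -- Domination at `X` and `-X` confines a linear functional to a product of compact intervals,
  -- where linearity is a closed condition.
  convert (isCompact_univ_pi fun X : boundedMeasurable Ω =>
    isCompact_Icc (a := -ρ (-X)) (b := ρ X)).inter_right
      (LinearMap.isClosed_range_coe (boundedMeasurable Ω) ℝ (RingHom.id ℝ)) using 1
  ext f
  constructor
  · rintro ⟨L, rfl, hL⟩
    refine ⟨fun X _ => ⟨?_, hL X⟩, L, rfl⟩
    have := hL (-X)
    rw [map_neg] at this
    linarith
  · rintro ⟨hf, L, rfl⟩
    exact ⟨L, rfl, fun X => (hf X trivial).2⟩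

/-- The probability measures whose expectation is dominated by `ρ`. -/
def dominatedMeasures (ρ : boundedMeasurable Ω → ℝ) : Set (ProbabilityMeasure Ω) :=
  {P | ∀ X : boundedMeasurable Ω, ∫ ω, (X : Ω → ℝ) ω ∂(P : Measure Ω) ≤ ρ X}

theorem isLUB_dominatedMeasures (hρ : IsSublinearOperator ρ) (hc : IsContinuousFromAbove ρ)
    (X : boundedMeasurable Ω) :
    IsLUB {r : ℝ | ∃ P ∈ dominatedMeasures ρ, r = ∫ ω, (X : Ω → ℝ) ω ∂(P : Measure Ω)} (ρ X) := by
  obtain ⟨L, hL, hX⟩ := hρ.exists_linear_le X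
  obtain ⟨P, hP⟩ := hρ.exists_integral_eq hc hL
  refine IsGreatest.isLUB ⟨⟨P, fun Y => (hP Y).trans_le (hL Y), ?_⟩, ?_⟩
  · rw [hP, hX]
  · rintro _ ⟨Q, hQ, rfl⟩
    exact hQ X

/-- If `B n` decreases to the empty set, the bound `P (B n) ≤ ρ (1_{B n})` is uniform in `P` and
tends to zero. -/
theorem exists_dominating_dominatedMeasures (hρ : IsSublinearOperator ρ)
    (hc : IsContinuousFromAbove ρ) :
    ∃ P₀ : ProbabilityMeasure Ω, ∀ P ∈ dominatedMeasures ρ,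
      (P : Measure Ω) ≪ (P₀ : Measure Ω) := by
  refine exists_dominating_probabilityMeasure ?_ fun B hB hanti hB0 ε hε => ?_
  · obtain ⟨_, P, hP, _⟩ := (hρ.isLUB_dominatedMeasures hc 0).nonempty
    exact ⟨P, hP⟩
  · have hlim := (hc (fun n => boundedIndicator (B n) (hB n))
      (fun ω m n hmn => Set.indicator_le_indicator_of_subset (hanti hmn)
        (fun _ => zero_le_one) ω)
      (fun ω => by
        have : ∃ n, ω ∉ B n := by
          by_contra! h
          exact (hB0 ▸ Set.mem_iInter.2 h : ω ∈ (∅ : Set Ω))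
        obtain ⟨n, hn⟩ := this
        refine tendsto_const_nhds.congr' ?_
        filter_upwards [eventually_ge_atTop n] with m hm
        exact (boundedIndicator_of_notMem _ fun h => hn (hanti hm h)).symm)).2
    have h0 := ENNReal.tendsto_ofReal hlim
    rw [ENNReal.ofReal_zero] at h0
    obtain ⟨n, hn⟩ := (h0.eventually_le_const (pos_iff_ne_zero.2 hε)).exists
    refine ⟨n, fun P hP => le_trans ?_ hn⟩
    have := hP (boundedIndicator (B n) (hB n))
    rw [integral_boundedIndicator] at this
    rw [← ofReal_measureReal]
    exact ENNReal.ofReal_le_ofReal this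

/-- The set is a continuous image of the compact set of dominated functionals: pairing a density
with `g` is evaluation of the functional at a bounded representative of `g`. -/
theorem isCompact_densitySet_dominatedMeasures (hρ : IsSublinearOperator ρ)
    (hc : IsContinuousFromAbove ρ) {P₀ : ProbabilityMeasure Ω}
    (hP₀ : ∀ P ∈ dominatedMeasures ρ, (P : Measure Ω) ≪ (P₀ : Measure Ω)) :
    IsCompact (densitySet P₀ (dominatedMeasures ρ)) := by
  set K := {f : boundedMeasurable Ω → ℝ |
      ∃ L : boundedMeasurable Ω →ₗ[ℝ] ℝ, (L : boundedMeasurable Ω → ℝ) = f ∧ ∀ X, L X ≤ ρ X}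
  have hK : CompactSpace K := isCompact_iff_compactSpace.1 (isCompact_linear_le ρ)
  have hex : ∀ f : K, ∃ P ∈ dominatedMeasures ρ, ∀ X : boundedMeasurable Ω,
      ∫ ω, (X : Ω → ℝ) ω ∂(P : Measure Ω) = (f : boundedMeasurable Ω → ℝ) X := by
    rintro ⟨_, L, rfl, hL⟩
    obtain ⟨P, hP⟩ := hρ.exists_integral_eq hc hL
    exact ⟨P, fun X => (hP X).trans_le (hL X), hP⟩
  choose Q hQ hQint using hex
  have hrange : densitySet P₀ (dominatedMeasures ρ) =
      Set.range fun f : K => toWeakL1 (P₀ : Measure Ω) (densityL1 P₀ (Q f)) := by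
    ext Z
    constructor
    · rintro ⟨P, hP, rfl⟩
      let L : boundedMeasurable Ω →ₗ[ℝ] ℝ :=
        { toFun := fun X => ∫ ω, (X : Ω → ℝ) ω ∂(P : Measure Ω)
          map_add' := fun X Y => integral_add (boundedMeasurable.integrable X _)
            (boundedMeasurable.integrable Y _)
          map_smul' := fun c X => integral_const_mul c _ }
      refine ⟨⟨L, L, rfl, hP⟩, ?_⟩
      have : Q ⟨L, L, rfl, hP⟩ = P :=
        probabilityMeasure_ext_of_integral_boundedMeasurable fun X => hQint _ X
      simp only [this]
    · rintro ⟨f, rfl⟩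
      exact ⟨Q f, hQ f, rfl⟩
  rw [hrange]
  refine isCompact_range (WeakBilin.continuous_of_continuous_eval _ fun g => ?_)
  obtain ⟨X, hX⟩ := exists_boundedMeasurable_ae_eq g
  have : ∀ f : K, pairingL1Linfty (P₀ : Measure Ω)
      (toWeakL1 (P₀ : Measure Ω) (densityL1 P₀ (Q f))) g = (f : boundedMeasurable Ω → ℝ) X :=
    fun f => (pairing_densityL1 (hP₀ _ (hQ f)) g hX).trans (hQint f X)
  simp only [this]
  exact (continuous_apply X).comp continuous_subtype_val

/-! ### Continuity from above by Dini's theorem -/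

/-- An upper expectation over a family with weakly compact densities is continuous from above. -/
theorem isContinuousFromAbove_of_isCompact (hρ : IsSublinearOperator ρ)
    {P₀ : ProbabilityMeasure Ω} {Pfam : Set (ProbabilityMeasure Ω)}
    (hsup : ∀ X : boundedMeasurable Ω,
      IsLUB {r : ℝ | ∃ P ∈ Pfam, r = ∫ ω, (X : Ω → ℝ) ω ∂(P : Measure Ω)} (ρ X))
    (hac : ∀ P ∈ Pfam, (P : Measure Ω) ≪ (P₀ : Measure Ω))
    (hcomp : IsCompact (densitySet P₀ Pfam)) : IsContinuousFromAbove ρ := by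
  intro ξ hanti hlim
  have hρanti : Antitone fun n => ρ (ξ n) := fun m n hmn =>
    hρ.monotone _ _ fun ω => hanti ω hmn
  refine ⟨hρanti, ?_⟩
  have hrep : ∀ n, ∃ g : Lp ℝ ∞ (P₀ : Measure Ω), (ξ n : Ω → ℝ) =ᵐ[(P₀ : Measure Ω)] g := by
    intro n
    obtain ⟨hm, C, hC⟩ := (ξ n).2
    have hmem : MemLp (ξ n : Ω → ℝ) ∞ (P₀ : Measure Ω) :=
      memLp_top_of_bound hm.aestronglyMeasurable C (ae_of_all _ hC)
    exact ⟨hmem.toLp _, hmem.coeFn_toLp.symm⟩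
  choose g hg using hrep
  have hpair : ∀ n, ∀ P ∈ Pfam, pairingL1Linfty (P₀ : Measure Ω)
      (toWeakL1 (P₀ : Measure Ω) (densityL1 P₀ P)) (g n) =
        ∫ ω, (ξ n : Ω → ℝ) ω ∂(P : Measure Ω) :=
    fun n P hP => pairing_densityL1 (hac P hP) (g n) (hg n)
  have hunif := Antitone.tendstoUniformlyOn_of_forall_tendsto hcomp
    (F := fun n (Z : WeakL1 (P₀ : Measure Ω)) => pairingL1Linfty (P₀ : Measure Ω) Z (g n))
    (f := fun _ => (0 : ℝ))
    (fun n => (WeakBilin.eval_continuous _ (g n)).continuousOn)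
    (by
      rintro _ ⟨P, hP, rfl⟩ m n hmn
      simp only [hpair _ P hP]
      exact integral_mono (boundedMeasurable.integrable _ _) (boundedMeasurable.integrable _ _)
        fun ω => hanti ω hmn)
    continuousOn_const
    (by
      rintro _ ⟨P, hP, rfl⟩
      simp only [hpair _ P hP]
      exact tendsto_integral_boundedMeasurable_of_antitone _ hanti hlim)
  have hnn : ∀ n, 0 ≤ ρ (ξ n) := fun n => by
    rw [← hρ.map_zero]
    exact hρ.monotone _ _ fun ω => (hanti ω).le_of_tendsto (hlim ω) n
  rw [Metric.tendstoUniformlyOn_iff] at hunif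
  rw [Metric.tendsto_nhds]
  intro ε hε
  filter_upwards [hunif (ε / 2) (half_pos hε)] with n hn
  -- Passing to the supremum loses strictness, hence `ε / 2`.
  have hle : ρ (ξ n) ≤ ε / 2 := (hsup (ξ n)).2 (by
    rintro _ ⟨P, hP, rfl⟩
    have := hn _ ⟨P, hP, rfl⟩
    simp only [hpair _ P hP, Real.dist_eq, zero_sub, abs_neg] at this
    exact (le_abs_self _).trans this.le)
  rw [Real.dist_eq, sub_zero, abs_of_nonneg (hnn n)]
  linarith

end IsSublinearOperator

theorem proposition2p2 {Ω : Type*} [MeasurableSpace Ω]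
    (ρ : boundedMeasurable Ω → ℝ) (hρ : IsSublinearOperator ρ) :
    IsContinuousFromAbove ρ ↔
      ∃ (P₀ : ProbabilityMeasure Ω) (Pfam : Set (ProbabilityMeasure Ω)),
        (∀ X : boundedMeasurable Ω,
          IsLUB {r : ℝ | ∃ P ∈ Pfam, r = ∫ ω, (X : Ω → ℝ) ω ∂(P : Measure Ω)} (ρ X)) ∧
        (∀ P ∈ Pfam, (P : Measure Ω) ≪ (P₀ : Measure Ω)) ∧
        IsCompact (densitySet P₀ Pfam) := by
  constructor
  · intro hc
    obtain ⟨P₀, hP₀⟩ := hρ.exists_dominating_dominatedMeasures hc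
    exact ⟨P₀, IsSublinearOperator.dominatedMeasures ρ, hρ.isLUB_dominatedMeasures hc, hP₀,
      hρ.isCompact_densitySet_dominatedMeasures hc hP₀⟩
  · rintro ⟨P₀, Pfam, hsup, hac, hcomp⟩
    exact hρ.isContinuousFromAbove_of_isCompact hsup hac hcomp
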